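/- For $n\ge 0$ let $[n]=\{0,1,\dots,n\}$ and give $[n]\times[n]$ the product order. Let $\mathrm{Cart}^n$ be the partially ordered set of non-empty up-sets of $[n]\times[n]$ (subsets $Q$ such that $x\in Q$ and $x\le y$ imply $y\in Q$), ordered by reverse inclusion: $Q\le Q'$ if and only if $Q'\subseteq Q$. Thus the infimum of two elements is $Q\wedge Q'=Q\cup Q'$. For $(p,q)\in[n]\times[n]$ put $$\varsigma^n(p,q)=\{(a,b)\in[n]\times[n] : a\ge p,\ b\ge q\},$$ $$\xi^n(p,q)=\varsigma^n(p,0)\wedge\varsigma^n(0,q),\qquad \eta^n(p,q)=\varsigma^n(p,n)\wedge\varsigma^n(n,q),$$ and let $$\boxplus^n_{(p,q)}=N\bigl(\mathrm{Cart}^n_{\xi^n(p,q)//\eta^n(p,q)}\bigr)\subseteq N(\mathrm{Cart}^n)$$ be the nerve of the full subposet $\{Q\in\mathrm{Cart}^n : \xi^n(p,q)\le Q\le\eta^n(p,q)\}$, regarded as a simplicial subset of the nerve of $\mathrm{Cart}^n$. **Lemma.** For every $n\ge 0$ the inclusion of simplicial sets $$\boxplus^n_{\mathrm{cart}}:=\bigcup_{0\le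 p\le n}\boxplus^n_{(p,n)}\hookrightarrow N(\mathrm{Cart}^n)$$ is inner anodyne, i.e. it has the left lifting property with respect to every inner fibration (every map of simplicial sets having the right lifting property with respect to all inner horn inclusions $\Lambda^m_i\hookrightarrow\Delta^m$, $0<i<m$). -/

import Mathlib

open CategoryTheory

namespace Cartesianization

/-- The partially ordered set `Cart^n` of non-empty up-sets of `[n] × [n]`, where
`[n] = {0, …, n}`. Mathlib orders `UpperSet` by reverse inclusion, which is the order wanted:
`Q ≤ Q'` means `Q' ⊆ Q`. -/
abbrev Cart (n : ℕ) : Type :=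
  {Q : UpperSet (Fin (n + 1) × Fin (n + 1)) // (Q : Set (Fin (n + 1) × Fin (n + 1))).Nonempty}

/-- Infima in `Cart^n` are those of up-sets, that is, unions of sets. -/
instance instSemilatticeInfCart (n : ℕ) : SemilatticeInf (Cart n) :=
  Subtype.semilatticeInf fun {_ _} hQ _ => by
    rw [UpperSet.coe_inf]
    exact hQ.mono Set.subset_union_left

/-- The map `ς^n : [n] × [n] → Cart^n` sending `(p, q)` to the principal up-set
of all `(a, b) ≥ (p, q)`. -/
def sigma (n : ℕ) (p q : Fin (n + 1)) : Cart n :=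
  ⟨UpperSet.Ici (p, q), ⟨(p, q), Set.mem_Ici.2 le_rfl⟩⟩

/-- `ξ^n(p, q) = ς^n(p, 0) ∧ ς^n(0, q)`. -/
def xi (n : ℕ) (p q : Fin (n + 1)) : Cart n :=
  sigma n p 0 ⊓ sigma n 0 q

/-- `η^n(p, q) = ς^n(p, n) ∧ ς^n(n, q)`. -/
def eta (n : ℕ) (p q : Fin (n + 1)) : Cart n :=
  sigma n p (Fin.last n) ⊓ sigma n (Fin.last n) q

/-- The inclusion of the full subposet `P_{a//b} = {x | a ≤ x ≤ b}` into `P`, as a functor. -/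
def intervalInclusion {P : Type} [PartialOrder P] (a b : P) : Set.Icc a b ⥤ P :=
  Monotone.functor (f := fun x : Set.Icc a b => (x : P)) fun _ _ h => h

/-- The nerve of `P_{a//b}`, as a simplicial subset of the nerve of `P`. -/
def nerveInterval {P : Type} [PartialOrder P] (a b : P) : (nerve P).Subcomplex :=
  SSet.Subcomplex.range (nerveMap (intervalInclusion a b))

/-- `⊞^n_{(p, q)} = N(Cart^n_{ξ^n(p, q)//η^n(p, q)})` inside `N(Cart^n)`. -/
def boxplus (n : ℕ) (p q : Fin (n + 1)) : (nerve (Cart n)).Subcomplex :=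
  nerveInterval (xi n p q) (eta n p q)

/-- `⊞^n_cart`, the union of the `⊞^n_{(p, n)}` over `0 ≤ p ≤ n`. -/
def boxplusCart (n : ℕ) : (nerve (Cart n)).Subcomplex :=
  ⨆ p : Fin (n + 1), boxplus n p (Fin.last n)

end Cartesianization

open CategoryTheory Simplicial

namespace Cartesianization

/-! The maps `c`, `d` given by `η(-, n)`, `ξ(-, n)` have adjoints `a ⊣ c` and `d ⊣ b` with `a ≤ b`,
so a chain `f` lies in the union exactly when `a` of its last term is at most `b (f 0)`. In any
other chain `a` first exceeds `b (f 0)` at some `f (i + 1)`; just before it, insert or delete the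
pivot `f (i + 1) ⊓ c (b (f 0))`. This pairs off the nondegenerate simplices outside the union. The
pivot is never first (`IsPivot.ne_zero`) nor last, so each pair is an inner horn filling;
`PivotChain.rank_lt` shows that the fillings can be ordered. -/

lemma mem_nerveInterval_iff {P : Type} [PartialOrder P] {x y : P} {n : ℕ}
    (s : (nerve P) _⦋n⦌) :
    s ∈ (nerveInterval x y).obj _ ↔ x ≤ s.obj 0 ∧ s.obj (Fin.last n) ≤ y := by
  constructor
  · rintro ⟨t, rfl⟩
    exact ⟨(t.obj 0).2.1, (t.obj (Fin.last n)).2.2⟩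
  · rintro ⟨h₀, h₁⟩
    let f : Fin (n + 1) → Set.Icc x y := fun i ↦
      ⟨s.obj i, h₀.trans (s.monotone (Fin.zero_le i)), (s.monotone (Fin.le_last i)).trans h₁⟩
    have hf : Monotone f := fun i j hij ↦ s.monotone hij
    exact ⟨hf.functor, nerve.ext_of_isThin rfl⟩

/-- Two Galois connections `a ⊣ c` and `d ⊣ b` between a meet-semilattice `P` and a linear order
`L`, which cut out of `P` the intervals `[d p, c p]`, that is, `{x | a x ≤ p ≤ b x}`. -/
structure IntervalSystem (P L : Type) [SemilatticeInf P] [LinearOrder L] where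
  /-- the least index `p` such that `x ≤ c p` -/
  a : P → L
  /-- the greatest index `p` such that `d p ≤ x` -/
  b : P → L
  /-- the upper bounds of the intervals -/
  c : L → P
  /-- the lower bounds of the intervals -/
  d : L → P
  gc_a_c : GaloisConnection a c
  gc_d_b : GaloisConnection d b
  a_le_b (x : P) : a x ≤ b x
  d_le_c (p q : L) : d p ≤ c q

namespace IntervalSystem

variable {P L : Type} [SemilatticeInf P] [LinearOrder L] (S : IntervalSystem P L)

/-- The subcomplex of the nerve of `P` generated by the intervals `[d p, c p]`. -/
def union : (nerve P).Subcomplex := ⨆ p : L, nerveInterval (S.d p) (S.c p)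

lemma mem_union_iff {n : ℕ} (s : (nerve P) _⦋n⦌) :
    s ∈ S.union.obj _ ↔ S.a (s.obj (Fin.last n)) ≤ S.b (s.obj 0) := by
  simp only [union, Subfunctor.iSup_obj, Set.mem_iUnion, mem_nerveInterval_iff]
  constructor
  · rintro ⟨p, h₀, h₁⟩
    exact (S.gc_a_c.le_iff_le.2 h₁).trans (S.gc_d_b.le_iff_le.1 h₀)
  · intro h
    exact ⟨_, S.gc_d_b.le_iff_le.2 h, S.gc_a_c.le_u_l _⟩

/-- The element at the position `i` of the chain `f` is the largest element `x ≤ f (i + 1)` such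
that `a x ≤ b (f 0)`, while `f (i + 1)` does not satisfy this inequality. -/
structure IsPivot {n : ℕ} (f : Fin (n + 2) → P) (i : Fin (n + 1)) : Prop where
  lt : S.b (f 0) < S.a (f i.succ)
  eq : f i.castSucc = f i.succ ⊓ S.c (S.b (f 0))

namespace IsPivot

variable {S} {n : ℕ} {f g : Fin (n + 2) → P} {i j : Fin (n + 1)}

lemma a_le (h : S.IsPivot f i) : S.a (f i.castSucc) ≤ S.b (f 0) := by
  rw [h.eq]
  exact S.gc_a_c.le_iff_le.2 inf_le_right

/-- Both `f 1` and `c (b (f 0))` lie above `d (b (f 1))`. Were their meet `f 0`, then `a (f 1) ≤ b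
(f 1) ≤ b (f 0)`, against the choice of `f 1`. -/
lemma ne_zero (h : S.IsPivot f i) : i ≠ 0 := by
  rintro rfl
  refine h.lt.not_ge (S.gc_d_b.le_iff_le.1 ?_)
  refine (le_inf (S.gc_d_b.le_iff_le.2 (S.a_le_b (f (Fin.succ 0)))) (S.d_le_c _ _)).trans h.eq.ge

lemma castSucc_ne_zero (h : S.IsPivot f i) : i.castSucc ≠ 0 := by
  simpa using h.ne_zero

lemma le_of_monotone (hf : Monotone f) (hi : S.IsPivot f i) (hj : S.IsPivot f j) : j ≤ i := by
  by_contra! hij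
  exact (hi.lt.trans_le (S.gc_a_c.monotone_l (hf (Fin.succ_le_castSucc_iff.2 hij)))).not_ge hj.a_le

lemma unique (hf : Monotone f) (hi : S.IsPivot f i) (hj : S.IsPivot f j) : i = j :=
  le_antisymm (le_of_monotone hf hj hi) (le_of_monotone hf hi hj)

lemma succAbove_zero (h : S.IsPivot f i) : i.castSucc.succAbove 0 = 0 :=
  Fin.succAbove_ne_zero_zero h.castSucc_ne_zero

lemma lt_a_iff (hf : Monotone f) (h : S.IsPivot f i) (k : Fin (n + 1)) :
    S.b (f 0) < S.a (f (i.castSucc.succAbove k)) ↔ i ≤ k := by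
  constructor
  · intro hk
    by_contra! hki
    rw [Fin.succAbove_castSucc_of_lt _ _ hki] at hk
    exact (hk.trans_le (S.gc_a_c.monotone_l (hf (Fin.castSucc_le_castSucc_iff.2 hki.le)))).not_ge
      h.a_le
  · intro hik
    rw [Fin.succAbove_castSucc_of_le _ _ hik]
    exact h.lt.trans_le (S.gc_a_c.monotone_l (hf (Fin.succ_le_succ_iff.2 hik)))

/-- Omitting the pivot loses nothing: the face keeps `f 0`, its values of `a` locate the pivot, and
these data determine the missing element. -/
lemma eq_of_face_eq (hf : Monotone f) (hg : Monotone g) (hi : S.IsPivot f i)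
    (hj : S.IsPivot g j)
    (hfg : ∀ k, f (i.castSucc.succAbove k) = g (j.castSucc.succAbove k)) : i = j ∧ f = g := by
  have h₀ : f 0 = g 0 := by simpa [hi.succAbove_zero, hj.succAbove_zero] using hfg 0
  have hij : i = j := by
    have (k : Fin (n + 1)) : i ≤ k ↔ j ≤ k := by
      rw [← hi.lt_a_iff hf, ← hj.lt_a_iff hg, h₀, hfg]
    exact le_antisymm ((this j).2 le_rfl) ((this i).1 le_rfl)
  subst hij
  refine ⟨rfl, funext fun k ↦ ?_⟩
  obtain rfl | ⟨k, rfl⟩ := Fin.eq_self_or_eq_succAbove i.castSucc k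
  · have := hfg i
    rw [Fin.succAbove_castSucc_self] at this
    rw [hi.eq, hj.eq, this, h₀]
  · exact hfg k

/-- A chain with a pivot is not obtained by omitting the pivot of another chain. -/
lemma ne_face {g : Fin (n + 3) → P} {j : Fin (n + 2)} (hg : StrictMono g)
    (hi : S.IsPivot f i) (hj : S.IsPivot g j) (hfg : ∀ k, f k = g (j.castSucc.succAbove k)) :
    False := by
  have h₀ : f 0 = g 0 := by rw [hfg, hj.succAbove_zero]
  have hij : j = i.succ := by
    refine le_antisymm ?_ ?_
    · rw [← hj.lt_a_iff hg.monotone, ← hfg, ← h₀]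
      exact hi.lt
    · by_contra! h
      have := (hj.lt_a_iff hg.monotone i.castSucc).2 (Fin.le_castSucc_iff.2 h)
      rw [← hfg, ← h₀] at this
      exact this.not_ge hi.a_le
  subst hij
  have h₁ := hfg i.succ
  rw [Fin.succAbove_castSucc_self] at h₁
  have h₂ : f i.castSucc = g i.succ.castSucc := by rw [hi.eq, hj.eq, h₁, h₀]
  rw [hfg] at h₂
  exact Fin.succAbove_ne _ _ (hg.injective h₂)

end IsPivot

/-- A strictly monotone chain of `P` which is not in `S.union` either contains its pivot, or
is obtained by omitting the pivot of a larger chain. -/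
lemma exists_isPivot {n : ℕ} {f : Fin (n + 1) → P} (hf : StrictMono f)
    (h : S.b (f 0) < S.a (f (Fin.last n))) :
    (∃ (m : ℕ) (hm : n = m + 1) (i : Fin (m + 1)),
      S.IsPivot (f ∘ Fin.cast (congr_arg (· + 1) hm).symm) i) ∨
    ∃ (g : Fin (n + 2) → P) (_ : StrictMono g) (i : Fin (n + 1)), S.IsPivot g i ∧
      ∀ k, g (i.castSucc.succAbove k) = f k := by
  obtain _ | n := n
  · exact (h.not_ge (S.a_le_b _)).elim
  obtain ⟨i, hi, hi'⟩ : ∃ i : Fin (n + 1), S.a (f i.castSucc) ≤ S.b (f 0) ∧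
      S.b (f 0) < S.a (f i.succ) := by
    by_contra! H
    refine h.not_ge ?_
    have (k : Fin (n + 2)) : S.a (f k) ≤ S.b (f 0) := by
      induction k using Fin.induction with
      | zero => exact S.a_le_b _
      | succ i hi => exact H i hi
    exact this _
  by_cases hM : f i.castSucc = f i.succ ⊓ S.c (S.b (f 0))
  · exact Or.inl ⟨n, rfl, i, hi', hM⟩
  · right
    have h₁ : f i.castSucc < f i.succ ⊓ S.c (S.b (f 0)) :=
      lt_of_le_of_ne (le_inf (hf.monotone i.castSucc_le_succ) (S.gc_a_c.le_iff_le.1 hi)) hM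
    have h₂ : f i.succ ⊓ S.c (S.b (f 0)) < f i.succ := by
      refine inf_lt_left.2 fun H ↦ hi'.not_ge (S.gc_a_c.le_iff_le.2 H)
    have h₃ : Fin.insertNth (α := fun _ ↦ P) i.succ.castSucc (f i.succ ⊓ S.c (S.b (f 0))) f 0 =
        f 0 := by
      rw [Fin.insertNth_apply_below (Fin.castSucc_pos (Fin.succ_pos i))]
      rfl
    have h₄ : Fin.insertNth (α := fun _ ↦ P) i.succ.castSucc (f i.succ ⊓ S.c (S.b (f 0))) f
        i.succ.succ = f i.succ := by
      simpa only [Fin.succAbove_castSucc_self] using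
        Fin.insertNth_apply_succAbove (α := fun _ ↦ P) i.succ.castSucc
          (f i.succ ⊓ S.c (S.b (f 0))) f i.succ
    refine ⟨Fin.insertNth i.succ.castSucc (f i.succ ⊓ S.c (S.b (f 0))) f, ?_, i.succ, ⟨?_, ?_⟩,
      fun k ↦ Fin.insertNth_apply_succAbove ..⟩
    · rw [Fin.strictMono_insertNth_iff]
      refine ⟨hf, fun k hk ↦ lt_of_le_of_lt (hf.monotone ?_) h₁,
        fun k hk ↦ h₂.trans_le (hf.monotone (Fin.castSucc_le_castSucc_iff.1 hk))⟩
      exact Fin.le_castSucc_iff.2 (Fin.castSucc_lt_castSucc_iff.1 hk)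
    · rwa [h₃, h₄]
    · rw [h₃, h₄, Fin.insertNth_apply_same]

/-- The strictly monotone chains of `P` which have a pivot. -/
structure PivotChain where
  /-- the dimension of the chain, minus one -/
  dim : ℕ
  /-- the chain -/
  chain : Fin (dim + 2) → P
  /-- the position of the pivot -/
  pos : Fin (dim + 1)
  strictMono : StrictMono chain
  isPivot : S.IsPivot chain pos

namespace PivotChain

variable {S} (x y : S.PivotChain)

/-- The simplex of the nerve of `P` given by a chain with a pivot. -/
def simplex : (nerve P) _⦋x.dim + 1⦌ := x.strictMono.monotone.functor

/-- The chain obtained by omitting the pivot. -/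
def face (k : Fin (x.dim + 1)) : P := x.chain (x.pos.castSucc.succAbove k)

lemma face_strictMono : StrictMono x.face :=
  x.strictMono.comp (Fin.strictMono_succAbove _)

lemma face_zero : x.face 0 = x.chain 0 := by
  rw [face, x.isPivot.succAbove_zero]

lemma face_pos : x.face x.pos = x.chain x.pos.succ := by
  rw [face, Fin.succAbove_castSucc_self]

lemma lt_a_face_iff (k : Fin (x.dim + 1)) : S.b (x.face 0) < S.a (x.face k) ↔ x.pos ≤ k := by
  rw [face_zero]
  exact x.isPivot.lt_a_iff x.strictMono.monotone k

/-- The part of the face opposite to the pivot which lies above the pivot. -/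
def upper : Set P := {z | z ∈ Set.range x.face ∧ S.b (x.face 0) < S.a z}

lemma isLeast_upper : IsLeast x.upper (x.chain x.pos.succ) := by
  rw [← face_pos]
  refine ⟨⟨⟨_, rfl⟩, (x.lt_a_face_iff _).2 le_rfl⟩, ?_⟩
  rintro _ ⟨⟨k, rfl⟩, hk⟩
  exact x.face_strictMono.monotone ((x.lt_a_face_iff k).1 hk)

variable {x y}

lemma ext_of_face (hd : x.dim = y.dim)
    (h : ∀ k, x.face k = y.face (Fin.cast (congr_arg (· + 1) hd) k)) : x = y := by
  obtain ⟨n, f, i, hf, hi⟩ := x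
  obtain ⟨m, g, j, hg, hj⟩ := y
  obtain rfl : n = m := hd
  obtain ⟨rfl, rfl⟩ := hi.eq_of_face_eq hf.monotone hg.monotone hj h
  rfl

lemma ext_of_range_face (hd : x.dim = y.dim) (h : Set.range x.face ⊆ Set.range y.face) :
    x = y := by
  refine ext_of_face hd fun k ↦ ?_
  have hy : StrictMono (y.face ∘ Fin.cast (congr_arg (· + 1) hd)) :=
    y.face_strictMono.comp (Fin.cast_strictMono _)
  refine congr_fun ((x.face_strictMono.range_inj hy).1 ?_) k
  rw [(Fin.rightInverse_cast (congr_arg (· + 1) hd)).surjective.range_comp y.face]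
  refine Set.eq_of_subset_of_ncard_le h ?_ (Set.finite_range _)
  rw [← Set.image_univ, ← Set.image_univ, Set.ncard_image_of_injective _ x.face_strictMono.injective,
    Set.ncard_image_of_injective _ y.face_strictMono.injective]
  simp [hd]

/-- The first element and the number of elements above the pivot. -/
noncomputable def rank (x : S.PivotChain) : Pᵒᵈ ×ₗ ℕ :=
  toLex (OrderDual.toDual (x.face 0), x.upper.ncard)

/-- Passing to a subchain can only raise the first element. If it stays fixed, the upper part can
only shrink, and it shrinks strictly unless the chains agree. -/
lemma rank_lt (hxy : x ≠ y) (hd : x.dim = y.dim)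
    (h : Set.range x.face ⊆ Set.range y.chain) : x.rank < y.rank := by
  rw [rank, rank, Prod.Lex.toLex_lt_toLex']
  have h₀ : y.face 0 ≤ x.face 0 := by
    obtain ⟨k, hk⟩ := h ⟨0, rfl⟩
    rw [← hk, face_zero]
    exact y.strictMono.monotone (Fin.zero_le k)
  refine ⟨h₀, fun h₁ ↦ ?_⟩
  replace h₁ : x.face 0 = y.face 0 := h₁
  have h₂ : x.upper ⊆ y.upper := by
    rintro z ⟨hz, hz'⟩
    rw [h₁] at hz'
    refine ⟨?_, hz'⟩
    obtain ⟨k, rfl⟩ := h hz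
    obtain rfl | ⟨k, rfl⟩ := Fin.eq_self_or_eq_succAbove y.pos.castSucc k
    · rw [face_zero] at hz'
      exact (hz'.not_ge y.isPivot.a_le).elim
    · exact ⟨k, rfl⟩
  refine Set.ncard_lt_ncard (h₂.ssubset_of_ne fun h₃ ↦ hxy (ext_of_range_face hd ?_))
    ((Set.finite_range _).subset fun _ hz ↦ hz.1)
  rintro _ ⟨k, rfl⟩
  obtain ⟨l, hl⟩ := h ⟨k, rfl⟩
  obtain rfl | ⟨l, rfl⟩ := Fin.eq_self_or_eq_succAbove y.pos.castSucc l
  -- Equal upper parts have the same least element, hence give the same pivot; but the pivot of `x`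
  -- is not in its own face.
  · exfalso
    have h₄ : x.chain x.pos.succ = y.chain y.pos.succ :=
      x.isLeast_upper.unique (h₃ ▸ y.isLeast_upper)
    rw [y.isPivot.eq, ← face_zero, ← h₁, ← h₄, face_zero, ← x.isPivot.eq] at hl
    exact Fin.succAbove_ne _ _ (x.strictMono.injective hl).symm
  · exact ⟨l, hl⟩

end PivotChain

open SSet

/-- The pairing which associates to a chain the chain from which its pivot is omitted. -/
def pairingCore : S.union.PairingCore where
  ι := S.PivotChain
  dim x := x.dim
  simplex x := x.simplex
  index x := x.pos.castSucc
  nonDegenerate₁ x := (PartialOrder.mem_nerve_nonDegenerate_iff_strictMono _).2 x.strictMono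
  nonDegenerate₂ x := (PartialOrder.mem_nerve_nonDegenerate_iff_strictMono _).2 x.face_strictMono
  notMem₁ x h := by
    rw [mem_union_iff] at h
    exact (x.isPivot.lt.trans_le (S.gc_a_c.monotone_l
      (x.strictMono.monotone (Fin.le_last _)))).not_ge h
  notMem₂ x h := by
    rw [mem_union_iff] at h
    exact ((x.lt_a_face_iff _).2 (Fin.le_last x.pos)).not_ge h
  injective_type₁' {x y} h := by
    obtain ⟨n, f, i, hf, hi⟩ := x
    obtain ⟨m, g, j, hg, hj⟩ := y
    obtain rfl : n = m := by simpa using SSet.S.dim_eq_of_mk_eq h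
    rw [SSet.S.ext_iff] at h
    obtain rfl : f = g := congr_arg (fun s : ComposableArrows P (n + 1) ↦ s.obj) h
    obtain rfl := hi.unique hf.monotone hj
    rfl
  injective_type₂' {x y} h := by
    obtain ⟨n, f, i, hf, hi⟩ := x
    obtain ⟨m, g, j, hg, hj⟩ := y
    obtain rfl : n = m := SSet.S.dim_eq_of_mk_eq h
    rw [SSet.S.ext_iff] at h
    refine PivotChain.ext_of_face rfl fun k ↦ ?_
    exact congr_arg (fun s : ComposableArrows P n ↦ s.obj k) h
  type₁_ne_type₂' x y h := by
    obtain ⟨n, f, i, hf, hi⟩ := x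
    obtain ⟨m, g, j, hg, hj⟩ := y
    obtain rfl : n + 1 = m := SSet.S.dim_eq_of_mk_eq h
    rw [SSet.S.ext_iff] at h
    exact hi.ne_face hg hj fun k ↦ congr_arg (fun s : ComposableArrows P (n + 1) ↦ s.obj k) h
  surjective' x := by
    obtain ⟨n, s, hs, hs', rfl⟩ := x.mk_surjective
    rw [PartialOrder.mem_nerve_nonDegenerate_iff_strictMono] at hs
    rw [mem_union_iff, not_le] at hs'
    obtain ⟨m, hm, i, hi⟩ | ⟨g, hg, i, hi, h⟩ := S.exists_isPivot hs hs'
    · obtain rfl : n = m + 1 := hm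
      exact ⟨⟨m, s.obj, i, hs, hi⟩, Or.inl rfl⟩
    · refine ⟨⟨n, g, i, hg, hi⟩, Or.inr ?_⟩
      refine congr_arg SSet.S.mk (nerve.ext_of_isThin (funext fun k ↦ (h k).symm))

instance : S.pairingCore.IsInner where
  ne_zero x := x.isPivot.castSucc_ne_zero
  ne_last x := Fin.castSucc_ne_last x.pos

/-- The rank function of the pairing. -/
noncomputable def weakRankFunction : S.pairingCore.WeakRankFunction (Pᵒᵈ ×ₗ ℕ) where
  rank := PivotChain.rank
  lt {x y} h hd := by
    refine PivotChain.rank_lt h.1 hd ?_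
    obtain ⟨f, _, hf⟩ := SSet.N.le_iff_exists_mono.1 h.2.le
    rintro _ ⟨k, rfl⟩
    exact ⟨f k, congr_arg (fun s : ComposableArrows P x.dim ↦ s.obj k) hf⟩

lemma innerAnodyneExtensions_union_ι [Finite P] : innerAnodyneExtensions S.union.ι := by
  have := S.weakRankFunction.isRegular
  exact S.pairingCore.pairing.innerAnodyneExtensions

end IntervalSystem

/-! ### Up-sets of the grid as an interval system -/

variable {n : ℕ}

lemma mem_of_le {Q : Cart n} {x x' y y' : Fin (n + 1)} (h : (x, y) ∈ Q.1) (hx : x ≤ x')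
    (hy : y ≤ y') : (x', y') ∈ Q.1 :=
  Q.1.upper (Prod.mk_le_mk.2 ⟨hx, hy⟩) h

lemma le_sigma_iff (Q : Cart n) (p q : Fin (n + 1)) : Q ≤ sigma n p q ↔ (p, q) ∈ Q.1 :=
  UpperSet.le_Ici

lemma le_eta_last_iff (Q : Cart n) (p : Fin (n + 1)) :
    Q ≤ eta n p (Fin.last n) ↔ (p, Fin.last n) ∈ Q.1 := by
  rw [eta, le_inf_iff, le_sigma_iff, le_sigma_iff, and_iff_left_iff_imp]
  exact fun h ↦ mem_of_le h (Fin.le_last p) le_rfl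

lemma xi_last_le_iff (Q : Cart n) (p : Fin (n + 1)) :
    xi n p (Fin.last n) ≤ Q ↔ ∀ x y, (x, y) ∈ Q.1 → y < Fin.last n → p ≤ x := by
  have (x y : Fin (n + 1)) : (x, y) ∈ (xi n p (Fin.last n)).1 ↔ p ≤ x ∨ Fin.last n ≤ y := by
    change (x, y) ∈ UpperSet.Ici (p, 0) ⊓ UpperSet.Ici (0, Fin.last n) ↔ _
    simp [UpperSet.mem_inf_iff, Prod.le_def]
  constructor
  · intro h x y hxy hy
    exact ((this x y).1 (h hxy)).resolve_right hy.not_ge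
  · rintro h ⟨x, y⟩ hxy
    exact (this x y).2 (or_iff_not_imp_right.2 fun hy ↦ h x y hxy (not_le.1 hy))

lemma last_mem (Q : Cart n) : (Fin.last n, Fin.last n) ∈ Q.1 := by
  obtain ⟨⟨x, y⟩, h⟩ := Q.2
  exact mem_of_le h (Fin.le_last x) (Fin.le_last y)

/-- The interval system on `Cart n` which defines `boxplusCart n`. -/
noncomputable def cartIntervalSystem (n : ℕ) : IntervalSystem (Cart n) (Fin (n + 1)) where
  a Q := sInf {x | (x, Fin.last n) ∈ Q.1}
  -- The set is empty if `Q` lies in the top row; its infimum is then the top index, as the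
  -- adjunction requires.
  b Q := sInf {x | ∃ y, (x, y) ∈ Q.1 ∧ y < Fin.last n}
  c p := eta n p (Fin.last n)
  d p := xi n p (Fin.last n)
  gc_a_c Q p := by
    rw [le_eta_last_iff]
    have h₀ : sInf {x | (x, Fin.last n) ∈ Q.1} ∈ {x | (x, Fin.last n) ∈ Q.1} :=
      csInf_mem ⟨_, last_mem Q⟩
    exact ⟨fun h ↦ mem_of_le h₀ h le_rfl, fun h ↦ sInf_le h⟩
  gc_d_b p Q := by
    rw [xi_last_le_iff, le_sInf_iff]
    exact ⟨fun h x ⟨y, hxy, hy⟩ ↦ h x y hxy hy, fun h x y hxy hy ↦ h x ⟨y, hxy, hy⟩⟩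
  a_le_b Q := by
    refine le_sInf fun x ⟨y, hxy, _⟩ ↦ sInf_le ?_
    exact mem_of_le hxy le_rfl (Fin.le_last y)
  d_le_c p q := by
    rw [le_eta_last_iff]
    exact mem_of_le ((le_sigma_iff _ 0 _).1 inf_le_right) (Fin.zero_le q) le_rfl

end Cartesianization

theorem mainTheorem7 (n : ℕ) :
    SSet.innerAnodyneExtensions (Cartesianization.boxplusCart n).ι :=
  (Cartesianization.cartIntervalSystem n).innerAnodyneExtensions_union_ι
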